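/- **Setting.** Let $A$ be a finite nonempty action set and $\mathcal X=\mathbb R^k$. A linear model consists, for each action $a$, of a reward mechanism $R=\langle w_a,X\rangle+u$, $u\sim\mu_a$, and a transition mechanism $X'=B_aX+\varepsilon$ with independent components $\varepsilon_i\sim\nu_{a,i}$ (independent of $X$ and $u$), together with an acyclic linear structural equation model (SEM) $X=CX+\eta$, with independent $\eta_j$, for the states $X$ of the recorded transitions. All these noise laws have finite second moment, and the $\eta_j$ have positive variance (e.g. Gaussian noise). Let $\mathbf{PA}(R)=\{j:\exists a,\ (w_a)_j\neq0\}$, $\mathbf{PA}(i)=\{j:\exists a,\ (B_a)_{ij}\ne 0\}$, and let $S=\mathbf{AN}(R)$ be the set consisting of $\mathbf{PA}(R)$ and all its ancestors in the graph with arrows $j\to i$ for $j\in\mathbf{PA}(i)$; $\phi_S(x)=[x]_S$. A family of environments $e\in\mathcal E$ is given by linear transition mechanisms $P_e(\cdot\mid x,a)$ (again with independent components) and acyclic linear SEMs for the recorded states, which arise from those of the model by interventions; the reward mechanism is common, and no environment changes the transition mechanism of a variable in $\mathbf{AN}(R)$ (block structure). The training data are, for $e\in\mathcal E_{\rm train}\subseteq\mathcal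 E$ and $a\in A$, the joint laws of $(X,R,X')$ with action $a$ in environment $e$. For a target $Y$ ($Y=R$ or $Y=X'_v$) a set $T\subseteq\{1,\dots,k\}$ is *invariant* if for every $a$ there are a vector $\gamma_a$ supported in $T$ and a law $F_a$ such that for all $e\in\mathcal E_{\rm train}$ the residual $Y-\langle\gamma_a,X\rangle$ has law $F_a$ and is independent of $[X]_T$. $\mathrm{ICP}(Y)$ is the intersection of all invariant sets ($\emptyset$ if there are none). *Iterated ICP* (Linear MISA) starts with $S_0=\emptyset$ and puts $S_{n+1}=\mathrm{ICP}(R)\cup\bigcup_{v\in S_n}\mathrm{ICP}(X'_v)$. **Part 1 (identifiability).** Assume that the training environments contain an observational one (recorded states as in the model) and that one of the following holds: 1. for each $j$ some training environment is the do-intervention $X_j\leftarrow c$ on $X_j$ alone, with $c\ne\mathbb E X_j$ (the observational mean); 2. for each $j$ some training environment is a noise intervention on $X_j$ alone: $\eta_j\leftarrow Z\eta_j$ with $1\ne\mathbb EZ^2<\infty$, or $\eta_j\leftarrow Z+\eta_j$ with $\mathbb E Z^2<\infty$ and ($\mathbb EZ\neq0$ or $\operatorname{Var}Z>0$), $Z$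 independent of all noise; 3. some training environment is a simultaneous noise intervention $\eta_j\leftarrow s_j\eta_j$ for all $j$ (possibly with the coefficients $C$ replaced by those of another acyclic SEM), where $s=(s_1,\dots,s_k)$ is drawn once from a law that is absolutely continuous with respect to Lebesgue measure. Then (in case 3 for almost every $s$) the causal feature set is identifiable: $\mathrm{ICP}(R)=\mathbf{PA}(R)$ and $\mathrm{ICP}(X'_v)=\mathbf{PA}(v)$ for all $v\in\mathbf{AN}(R)$; iterated ICP returns $\mathbf{AN}(R)$, i.e. $S_n=\mathbf{AN}(R)$ for all $n\ge k$; and any other such family with the same training laws has the same set $\mathbf{AN}(R)$. **Part 2 (insufficient interventions).** Call $\phi$ model-irrelevant over a set $T$ of environments if for all $e,e'\in T$, all $a$, and all $x,y$ with $\phi(x)=\phi(y)$, the expected rewards of $(x,a)$ and $(y,a)$ agree and the law of $\phi(X')$ under $P_e(\cdot\mid x,a)$ equals that under $P_{e'}(\cdot\mid y,a)$. Suppose $m\notin S=\mathbf{AN}(R)$ and the next value of $x_m$ is a constant $c$ in every training environment (the same $c$ for all of them). Then $\phi_{S\cup\{m\}}$ is model-irrelevant over $\mathcal E_{\rm train}$;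 but if $\mathcal E_{\rm train}\neq\emptyset$ and some $e\in\mathcal E$ contains the intervention $x_m\leftarrow c+\mathcal N(0,\sigma^2)$ with $\sigma^2>0$, it is not model-irrelevant over $\mathcal E$. Such families exist in which, moreover, every environment is an intervention on a single variable, the training environments satisfy none of 1–3, and $\phi_{S\cup\{m\}}$ fails to be model-irrelevant already over some single environment $e\in\mathcal E$. -/

import Mathlib

open MeasureTheory ProbabilityTheory

namespace CausalMISA

noncomputable section

/-- Observations `x ∈ ℝᵏ`. -/
abbrev Obs (k : ℕ) : Type := Fin k → ℝ

/-- A linear structural equation model `X_i = ∑ j, coef i j * X_j + ε_i` with independent noise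
terms `ε_i ∼ noise i`. -/
structure SEM (k : ℕ) where
  coef : Matrix (Fin k) (Fin k) ℝ
  noise : Fin k → Measure ℝ

/-- The directed graph `j → i :⇔ C i j ≠ 0` has no directed cycle. -/
def Acyclic {k : ℕ} (C : Matrix (Fin k) (Fin k) ℝ) : Prop :=
  ∀ i, ¬ Relation.TransGen (fun j l => C l j ≠ 0) i i

namespace SEM

variable {k : ℕ}

/-- The law of the solution `X = (1 - C)⁻¹ ε` of `X = C X + ε`. For an acyclic `C` the matrix
`1 - C` is invertible. -/
def law (M : SEM k) : Measure (Obs k) :=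
  (Measure.pi M.noise).map (fun ε => (1 - M.coef)⁻¹.mulVec ε)

/-- The do-intervention `X_j ← c`. -/
def doAt (M : SEM k) (j : Fin k) (c : ℝ) : SEM k where
  coef := M.coef.updateRow j 0
  noise := Function.update M.noise j (Measure.dirac c)

/-- The multiplicative noise intervention `ε_j ← Z * ε_j`, with `Z ∼ α` independent of the noise. -/
def mulNoiseAt (M : SEM k) (j : Fin k) (α : Measure ℝ) : SEM k where
  coef := M.coef
  noise := Function.update M.noise j ((α.prod (M.noise j)).map (fun p => p.1 * p.2))

/-- The additive noise intervention `ε_j ← Z + ε_j`, with `Z ∼ α` independent of the noise. -/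
def addNoiseAt (M : SEM k) (j : Fin k) (α : Measure ℝ) : SEM k where
  coef := M.coef
  noise := Function.update M.noise j ((α.prod (M.noise j)).map (fun p => p.1 + p.2))

/-- The simultaneous noise intervention `ε_j ← s j * ε_j` on all variables, where the linear
coefficients may change to `C`. -/
def scaleAll (M : SEM k) (C : Matrix (Fin k) (Fin k) ℝ) (s : Fin k → ℝ) : SEM k where
  coef := C
  noise := fun j => (M.noise j).map (fun u => s j * u)

end SEM

/-- The mechanisms without intervention: for every action `a`,
the reward is `R = ⟨rewCoef a, X⟩ + u`, `u ∼ rewNoise a`, the next state is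
`X'_i = ∑ j, trCoef a i j * X_j + ε_i`, with independent `ε_i ∼ trNoise a i`, and the states `X` of
the recorded transitions follow the structural equation model `state`. -/
structure Model (A : Type*) (k : ℕ) where
  rewCoef : A → Fin k → ℝ
  rewNoise : A → Measure ℝ
  trCoef : A → Matrix (Fin k) (Fin k) ℝ
  trNoise : A → Fin k → Measure ℝ
  state : SEM k

/-- The mechanisms of the next state and of the recorded state in one environment. The reward
mechanism is common to all environments. -/
structure Environment (A : Type*) (k : ℕ) where
  trCoef : A → Matrix (Fin k) (Fin k) ℝ
  trNoise : A → Fin k → Measure ℝ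
  state : SEM k

variable {A ι : Type*} {k : ℕ}

/-- The transition law `P_e(· | x, a)`; the components of the next state are independent given
`x` and `a`. -/
def Environment.transition (E : Environment A k) (x : Obs k) (a : A) : Measure (Obs k) :=
  (Measure.pi (E.trNoise a)).map (fun ε => (E.trCoef a).mulVec x + ε)

namespace Model

/-- The expected reward `R(x, a)`. -/
def expReward (M : Model A k) (x : Obs k) (a : A) : ℝ :=
  ∫ r, r ∂((M.rewNoise a).map (fun u => M.rewCoef a ⬝ᵥ x + u))

/-- `j` at time `t` is a direct cause of `i` at time `t + 1`. -/
def Edge (M : Model A k) (j i : Fin k) : Prop :=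
  ∃ a, M.trCoef a i j ≠ 0

/-- Causal parents of a target: `none` is the reward, `some i` is the next value of `x_i`. -/
def parents (M : Model A k) : Option (Fin k) → Set (Fin k)
  | none => {j | ∃ a, M.rewCoef a j ≠ 0}
  | some i => {j | M.Edge j i}

/-- `AN(R)`: the variables on which the reward depends, and all their ancestors. -/
def ancestors (M : Model A k) : Set (Fin k) :=
  {j | ∃ i ∈ M.parents none, Relation.ReflTransGen M.Edge j i}

/-- The joint law of a recorded transition `(X, R, X')` with action `a` in the environment `E`. -/
def dataLaw (M : Model A k) (E : Environment A k) (a : A) : Measure (Obs k × ℝ × Obs k) :=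
  (E.state.law.prod ((M.rewNoise a).prod (Measure.pi (E.trNoise a)))).map
    (fun p => (p.1, M.rewCoef a ⬝ᵥ p.1 + p.2.1, (E.trCoef a).mulVec p.1 + p.2.2))

end Model

/-- A square-integrable probability law on the line. -/
def SquareIntegrableLaw (μ : Measure ℝ) : Prop :=
  IsProbabilityMeasure μ ∧ Integrable (fun u => u ^ 2) μ

/-- The standing assumptions on a linear family of environments: noise laws are probability laws
with finite variance (nonzero for the recorded states), the structural equations of the recorded
states are acyclic, and (block structure) no environment changes the transition mechanism of a
causal ancestor of the reward. -/
structure IsBlockFamily (M : Model A k) (env : ι → Environment A k) : Prop where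
  rewNoise : ∀ a, SquareIntegrableLaw (M.rewNoise a)
  trNoise : ∀ a i, SquareIntegrableLaw (M.trNoise a i)
  stateNoise : ∀ j, SquareIntegrableLaw (M.state.noise j)
  stateVar : ∀ j, 0 < Var[id; M.state.noise j]
  stateAcyclic : Acyclic M.state.coef
  envTrNoise : ∀ e a i, IsProbabilityMeasure ((env e).trNoise a i)
  envStateNoise : ∀ e j, IsProbabilityMeasure ((env e).state.noise j)
  envStateAcyclic : ∀ e, Acyclic (env e).state.coef
  block : ∀ e, ∀ i ∈ M.ancestors, ∀ a,
    (env e).trCoef a i = M.trCoef a i ∧ (env e).trNoise a i = M.trNoise a i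

/-- Every environment is a (do- or soft) intervention on a single variable `i`: the mechanisms of
all other variables are unchanged, and the new mechanism of `i` adds no causal arrow. -/
def SingleVariableInterventions (M : Model A k) (env : ι → Environment A k) : Prop :=
  ∀ e, ∃ i,
    (∀ j, j ≠ i → (env e).state.coef j = M.state.coef j ∧
      (env e).state.noise j = M.state.noise j ∧
      ∀ a, (env e).trCoef a j = M.trCoef a j ∧ (env e).trNoise a j = M.trNoise a j) ∧
    (∀ j, M.state.coef i j = 0 → (env e).state.coef i j = 0) ∧
    (∀ a j, ¬ M.Edge j i → (env e).trCoef a i j = 0)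

/-! ### Sufficient interventions -/

/-- An observational training environment, and for each variable a do-intervention on that variable
alone, at a value that is not its observational mean. -/
def DoSufficient (M : Model A k) (env : ι → Environment A k) (train : Set ι) : Prop :=
  (∃ e ∈ train, (env e).state = M.state) ∧
  ∀ j, ∃ e ∈ train, ∃ c : ℝ, c ≠ ∫ x, x j ∂M.state.law ∧ (env e).state = M.state.doAt j c

/-- An observational training environment, and for each variable a noise intervention on that
variable alone: `ε_j ← Z * ε_j` with `1 ≠ E Z² < ∞`, or `ε_j ← Z + ε_j` with `E Z² < ∞` and
`E Z ≠ 0` or `Var Z > 0`. -/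
def NoiseSufficient (M : Model A k) (env : ι → Environment A k) (train : Set ι) : Prop :=
  (∃ e ∈ train, (env e).state = M.state) ∧
  ∀ j, ∃ e ∈ train, ∃ α : Measure ℝ, SquareIntegrableLaw α ∧
    ((∫ z, z ^ 2 ∂α ≠ 1 ∧ (env e).state = M.state.mulNoiseAt j α) ∨
     ((∫ z, z ∂α ≠ 0 ∨ 0 < Var[id; α]) ∧ (env e).state = M.state.addNoiseAt j α))

/-- An observational training environment, and one where the noise of every variable `j` is
multiplied by `s j` (and the coefficients may have changed to `C`). -/
def Simultaneous (M : Model A k) (env : ι → Environment A k) (train : Set ι)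
    (C : Matrix (Fin k) (Fin k) ℝ) (s : Fin k → ℝ) : Prop :=
  (∃ e ∈ train, (env e).state = M.state) ∧
  ∃ e ∈ train, (env e).state = M.state.scaleAll C s

/-! ### Invariant causal prediction

Everything here is a function of the laws `D e a` of the recorded transitions only. -/

/-- The value of a target in a recorded transition `(x, r, x')`. -/
def targetValue : Option (Fin k) → Obs k × ℝ × Obs k → ℝ
  | none, p => p.2.1
  | some i, p => p.2.2 i

/-- Residual of the target `v` after linear prediction from the current state. -/
def residual (v : Option (Fin k)) (γ : Fin k → ℝ) (p : Obs k × ℝ × Obs k) : ℝ :=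
  targetValue v p - γ ⬝ᵥ p.1

/-- The invariance hypothesis for the predictor set `S` of the target `v`: for each action there
are coefficients supported in `S` such that the residual has the same law in all training
environments and is independent of the predictors in `S`. -/
def InvariantSet (D : ι → A → Measure (Obs k × ℝ × Obs k)) (train : Set ι) (v : Option (Fin k))
    (S : Set (Fin k)) : Prop :=
  ∃ γ : A → Fin k → ℝ, (∀ a, ∀ j ∉ S, γ a j = 0) ∧
    ∃ F : A → Measure ℝ, ∀ e ∈ train, ∀ a,
      (D e a).map (residual v (γ a)) = F a ∧
      IndepFun (residual v (γ a)) (fun p (j : S) => p.1 j) (D e a)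

/-- The identifiable causal predictors: the intersection of all invariant sets (empty if there is no
invariant set). -/
def icp (D : ι → A → Measure (Obs k × ℝ × Obs k)) (train : Set ι) (v : Option (Fin k)) :
    Set (Fin k) :=
  {j | (∃ S, InvariantSet D train v S) ∧ ∀ S, InvariantSet D train v S → j ∈ S}

/-- Iterated ICP (linear MISA) after `n` rounds: start from the reward, and add in each round the
predictors that ICP returns for the reward and for all variables found so far. -/
def linearMISA (D : ι → A → Measure (Obs k × ℝ × Obs k)) (train : Set ι) (n : ℕ) : Set (Fin k) :=
  (fun S => icp D train none ∪ ⋃ v ∈ S, icp D train (some v))^[n] ∅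

/-- The causal feature set `AN(R)` is identifiable from the laws of the recorded transitions in
the training environments: ICP returns the parents of the reward and of every variable in `AN(R)`,
iterated ICP returns `AN(R)` (after at most `k` rounds), and every family with the same
training laws has the same causal feature set. -/
structure Identifiable (M : Model A k) (env : ι → Environment A k) (train : Set ι) : Prop where
  icp_reward : icp (fun e => M.dataLaw (env e)) train none = M.parents none
  icp_ancestor : ∀ v ∈ M.ancestors,
    icp (fun e => M.dataLaw (env e)) train (some v) = M.parents (some v)
  misa : ∀ n, k ≤ n → linearMISA (fun e => M.dataLaw (env e)) train n = M.ancestors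
  unique : ∀ (M' : Model A k) (env' : ι → Environment A k), IsBlockFamily M' env' →
    (∀ e ∈ train, ∀ a, M'.dataLaw (env' e) a = M.dataLaw (env e) a) →
    M'.ancestors = M.ancestors

/-! ### Model-irrelevance abstractions -/

/-- `φ` is a model-irrelevance abstraction over the environments in `T` (a bisimulation on the
union of these environments): observations with the same abstract state have the same expected
reward and the same law of the next abstract state, within and across the environments. -/
def ModelIrrelevant {Z : Type*} [MeasurableSpace Z] (M : Model A k) (env : ι → Environment A k)
    (T : Set ι) (φ : Obs k → Z) : Prop :=
  ∀ e ∈ T, ∀ e' ∈ T, ∀ (a : A) (x y : Obs k), φ x = φ y →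
    M.expReward x a = M.expReward y a ∧
    ((env e).transition x a).map φ = ((env e').transition y a).map φ

/-- The abstraction `x ↦ [x]_S`. -/
def restrictTo (S : Set (Fin k)) (x : Obs k) : S → ℝ := fun j => x j

/-- In the environment `E` the next value of `x_m` has law `μ`, whatever the current state and
action. -/
def Environment.SetsNext (E : Environment A k) (m : Fin k) (μ : Measure ℝ) : Prop :=
  ∀ a, E.trCoef a m = 0 ∧ E.trNoise a m = μ

end

end CausalMISA

/-! Let `v` be the reward or the next value of a variable in `AN(R)`, with causal coefficients `β`.
By the block structure the residual of `v` for coefficients `γ` is `⟨δ, X⟩ + u` with `δ = β - γ`, in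
every environment, where `u` is independent of `X` and its law does not depend on the environment
(`map_dataLaw`). For `γ = β` this shows that the parents form an invariant set, so ICP returns no
more than the parents.

Conversely, an invariant set `S` with coefficients `γ` makes the mean and variance of `⟨δ, X⟩` agree
across training environments (`exists_moments_eq`). Solving the SEM gives `⟨δ, X⟩ = ⟨w, η⟩` with `w
= δ (1 - C)⁻¹`. A do-intervention on `X_j` moves the mean by a nonzero multiple of `w_j`; a noise
intervention changes only the `j`-th term of the mean or of the variance `∑ w_j² Var η_j`. Hence `w
= 0`, so `δ = 0`, so `β = γ` is supported in `S`.

For simultaneous scaling the new variance is a quadratic form in `s`, nonzero if `δ ≠ 0`, so it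
meets the observational value only on a null set. This set must not depend on `γ`: the residual is
uncorrelated with `[X]_S` in the observational environment, and these normal equations determine `δ`
from `v`, the action and `S`, which leaves finitely many null sets.

Iterated ICP then follows the parent relation from the reward. For uniqueness, the causal
coefficients of any family with the same training laws are the regression coefficients on all of `X`
in the observational environment (`targetCoef_eq_of_dataLaw_eq`).

In Part 2 the next abstract state has independent components: those in `AN(R)` have unchanged
mechanisms with parents in `AN(R)`, and the `m`-th is a point mass until a Gaussian test environment
replaces it. -/

open MeasureTheory ProbabilityTheory

namespace CausalMISA

variable {A ι : Type*} {k : ℕ}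

/-! ### Structural equation models -/

/-- A kernel vector of `1 - C` satisfies `v i = ∑ j, C i j * v j`, so it vanishes by well-founded
induction along the acyclic graph. -/
lemma Acyclic.isUnit_det {C : Matrix (Fin k) (Fin k) ℝ} (hC : Acyclic C) :
    IsUnit (1 - C).det := by
  rw [isUnit_iff_ne_zero]
  intro hdet
  obtain ⟨v, hv, h0⟩ := Matrix.exists_mulVec_eq_zero_iff.mpr hdet
  have : Std.Irrefl (Relation.TransGen (fun j l => C l j ≠ 0)) := ⟨hC⟩
  have hwf := Finite.wellFounded_of_trans_of_irrefl (Relation.TransGen (fun j l => C l j ≠ 0))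
  refine hv (funext fun i => ?_)
  induction i using hwf.induction with
  | _ i ih =>
    have hi : v i = ∑ j, C i j * v j := by
      have := congrFun h0 i
      rw [Matrix.sub_mulVec, Matrix.one_mulVec, Pi.sub_apply, Pi.zero_apply, sub_eq_zero] at this
      exact this
    rw [hi]
    refine Finset.sum_eq_zero fun j _ => ?_
    by_cases hj : C i j = 0
    · simp [hj]
    · simp [ih j (Relation.TransGen.single hj)]

lemma SquareIntegrableLaw.memLp {μ : Measure ℝ} (h : SquareIntegrableLaw μ) : MemLp id 2 μ :=
  (memLp_two_iff_integrable_sq aestronglyMeasurable_id).2 h.2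

lemma SquareIntegrableLaw.of_memLp {Ω : Type*} [MeasurableSpace Ω] {P : Measure Ω}
    [IsProbabilityMeasure P] {f : Ω → ℝ} (hf : Measurable f) (h : MemLp f 2 P) :
    SquareIntegrableLaw (P.map f) := by
  refine ⟨Measure.isProbabilityMeasure_map hf.aemeasurable, ?_⟩
  rw [integrable_map_measure (by fun_prop) hf.aemeasurable]
  exact h.integrable_sq

lemma squareIntegrableLaw_dirac (c : ℝ) : SquareIntegrableLaw (Measure.dirac c) :=
  ⟨inferInstance, integrable_dirac (by simp)⟩

/-- All noise laws are square-integrable and `1 - C` is invertible. -/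
structure SEM.Regular (M : SEM k) : Prop where
  noise : ∀ j, SquareIntegrableLaw (M.noise j)
  isUnit : IsUnit (1 - M.coef).det

namespace SEM

/-- The weights of the noise variables in the linear functional `x ↦ ⟨δ, x⟩` of the solution. -/
noncomputable def noiseWeights (M : SEM k) (δ : Fin k → ℝ) : Fin k → ℝ :=
  Matrix.vecMul δ (1 - M.coef)⁻¹

lemma noiseWeights_eq_zero {M : SEM k} (h : IsUnit (1 - M.coef).det) {δ : Fin k → ℝ}
    (hδ : M.noiseWeights δ = 0) : δ = 0 := by
  have := congrArg (fun v => Matrix.vecMul v (1 - M.coef)) hδ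
  simpa [noiseWeights, Matrix.vecMul_vecMul, Matrix.nonsing_inv_mul _ h] using this

lemma measurable_solve (M : SEM k) :
    Measurable (fun ε : Obs k => (1 - M.coef)⁻¹.mulVec ε) := by
  unfold Matrix.mulVec dotProduct
  fun_prop

@[fun_prop]
lemma _root_.CausalMISA.measurable_dotProduct (δ : Fin k → ℝ) :
    Measurable (fun x : Obs k => δ ⬝ᵥ x) := by
  unfold dotProduct
  fun_prop

lemma dotProduct_solve (M : SEM k) (δ : Fin k → ℝ) (ε : Obs k) :
    δ ⬝ᵥ (1 - M.coef)⁻¹.mulVec ε = M.noiseWeights δ ⬝ᵥ ε := by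
  rw [noiseWeights, Matrix.dotProduct_mulVec]

lemma isProbabilityMeasure_law (M : SEM k) (h : ∀ j, IsProbabilityMeasure (M.noise j)) :
    IsProbabilityMeasure M.law :=
  Measure.isProbabilityMeasure_map M.measurable_solve.aemeasurable

namespace Regular

variable {M : SEM k} (hM : M.Regular)
include hM

lemma isProbabilityMeasure : IsProbabilityMeasure M.law :=
  M.isProbabilityMeasure_law fun j => (hM.noise j).1

lemma memLp_dotProduct_noise (θ : Fin k → ℝ) :
    MemLp (fun ε : Obs k => θ ⬝ᵥ ε) 2 (Measure.pi M.noise) := by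
  have := fun j => (hM.noise j).1
  unfold dotProduct
  exact memLp_finsetSum _ fun j _ =>
    ((hM.noise j).memLp.comp_measurePreserving (measurePreserving_eval _ j)).const_mul (θ j)

lemma memLp (δ : Fin k → ℝ) : MemLp (fun x : Obs k => δ ⬝ᵥ x) 2 M.law := by
  have := fun j => (hM.noise j).1
  rw [law, memLp_map_measure_iff (by fun_prop) M.measurable_solve.aemeasurable]
  simpa only [Function.comp_def, dotProduct_solve] using hM.memLp_dotProduct_noise _

lemma memLp_apply (j : Fin k) : MemLp (fun x : Obs k => x j) 2 M.law := by
  simpa using hM.memLp (Pi.single j 1)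

lemma integral_dotProduct (δ : Fin k → ℝ) :
    ∫ x, δ ⬝ᵥ x ∂M.law = M.noiseWeights δ ⬝ᵥ (fun j => ∫ u, u ∂M.noise j) := by
  have := fun j => (hM.noise j).1
  rw [law, integral_map M.measurable_solve.aemeasurable (by fun_prop)]
  simp only [dotProduct_solve]
  unfold dotProduct
  have hi : ∀ j, Integrable (fun ε : Obs k => ε j) (Measure.pi M.noise) := fun j =>
    ((hM.noise j).memLp.comp_measurePreserving
      (measurePreserving_eval M.noise j)).integrable one_le_two
  rw [integral_finsetSum _ fun j _ => (hi j).const_mul _]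
  refine Finset.sum_congr rfl fun j _ => ?_
  rw [integral_const_mul]
  congr 1
  have h := integral_map (μ := Measure.pi M.noise) (φ := Function.eval j) (f := fun u : ℝ => u)
    (measurable_pi_apply j).aemeasurable (by fun_prop)
  rw [(measurePreserving_eval M.noise j).map_eq] at h
  exact h.symm

lemma variance_dotProduct (δ : Fin k → ℝ) :
    Var[fun x => δ ⬝ᵥ x; M.law] = ∑ j, M.noiseWeights δ j ^ 2 * Var[id; M.noise j] := by
  have := fun j => (hM.noise j).1
  rw [law, variance_map (by fun_prop) M.measurable_solve.aemeasurable]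
  simp only [Function.comp_def, dotProduct_solve]
  have h := variance_sum_pi (μ := M.noise) (X := fun j u => M.noiseWeights δ j * u)
    fun j => (hM.noise j).memLp.const_mul _
  have hv : ∀ j, Var[fun u => M.noiseWeights δ j * u; M.noise j] =
      M.noiseWeights δ j ^ 2 * Var[id; M.noise j] := fun j => variance_const_mul _ id _
  rw [← Finset.sum_congr rfl fun j _ => hv j, ← h]
  congr 1
  ext ε
  simp [dotProduct]

/-- The covariance form of the state is nondegenerate: a sum of squared weights times positive
variances vanishes only if all weights do, and `1 - C` is invertible. -/
lemma eq_zero_of_variance_eq_zero (hpos : ∀ j, 0 < Var[id; M.noise j]) {δ : Fin k → ℝ}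
    (hδ : Var[fun x => δ ⬝ᵥ x; M.law] = 0) : δ = 0 := by
  rw [hM.variance_dotProduct, Finset.sum_eq_zero_iff_of_nonneg
    fun j _ => mul_nonneg (sq_nonneg _) (hpos j).le] at hδ
  refine noiseWeights_eq_zero hM.isUnit (funext fun j => ?_)
  simpa [(hpos j).ne'] using hδ j (Finset.mem_univ j)

/-- The mean of the solution solves the structural equations of the mean noise. -/
lemma mulVec_mean :
    (1 - M.coef).mulVec (fun j => ∫ x, x j ∂M.law) = fun j => ∫ u, u ∂M.noise j := by
  have h : (fun j => ∫ x, x j ∂M.law) =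
      (1 - M.coef)⁻¹.mulVec (fun j => ∫ u, u ∂M.noise j) := by
    ext j
    have := hM.integral_dotProduct (Pi.single j 1)
    rw [← dotProduct_solve] at this
    simpa using this
  rw [h, Matrix.mulVec_mulVec, Matrix.mul_nonsing_inv _ hM.isUnit, Matrix.one_mulVec]

lemma integral_dotProduct_eq_dotProduct_mean (δ : Fin k → ℝ) :
    ∫ x, δ ⬝ᵥ x ∂M.law = δ ⬝ᵥ (fun j => ∫ x, x j ∂M.law) := by
  have := hM.isProbabilityMeasure
  unfold dotProduct
  rw [integral_finsetSum _ fun j _ => ((hM.memLp_apply j).integrable one_le_two).const_mul _]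
  simp only [integral_const_mul]

/-! ### Moments of a residual `⟨δ, X⟩ + u` with `u` independent of `X`. -/

section Residual

variable {μ : Measure ℝ} (hμ : SquareIntegrableLaw μ)
include hμ

lemma memLp_residual (δ : Fin k → ℝ) :
    MemLp (fun q : Obs k × ℝ => δ ⬝ᵥ q.1 + q.2) 2 (M.law.prod μ) := by
  have := hM.isProbabilityMeasure
  have := hμ.1
  exact ((hM.memLp δ).comp_fst μ).add (hμ.memLp.comp_snd M.law)

lemma integral_residual (δ : Fin k → ℝ) :
    ∫ q : Obs k × ℝ, δ ⬝ᵥ q.1 + q.2 ∂(M.law.prod μ) = ∫ x, δ ⬝ᵥ x ∂M.law + ∫ u, u ∂μ := by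
  have := hM.isProbabilityMeasure
  have := hμ.1
  have h2 : Integrable (fun q : Obs k × ℝ => q.2) (M.law.prod μ) :=
    (hμ.memLp.comp_snd M.law).integrable one_le_two
  rw [integral_add (((hM.memLp δ).comp_fst μ).integrable one_le_two) h2]
  congr 1
  · rw [integral_fun_fst (fun x : Obs k => δ ⬝ᵥ x)]; simp
  · rw [integral_fun_snd (fun u : ℝ => u)]; simp

lemma variance_residual (δ : Fin k → ℝ) :
    Var[fun q : Obs k × ℝ => δ ⬝ᵥ q.1 + q.2; M.law.prod μ] =
      Var[fun x => δ ⬝ᵥ x; M.law] + Var[id; μ] := by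
  have := hM.isProbabilityMeasure
  have := hμ.1
  have h := variance_add_prod (hM.memLp δ) hμ.memLp
  simpa only [id_eq] using h

lemma covariance_residual (δ : Fin k → ℝ) (j : Fin k) :
    cov[fun q : Obs k × ℝ => δ ⬝ᵥ q.1 + q.2, fun q => q.1 j; M.law.prod μ] =
      cov[fun x => δ ⬝ᵥ x, fun x => x j; M.law] := by
  have := hM.isProbabilityMeasure
  have := hμ.1
  have h := covariance_add_left ((hM.memLp δ).comp_fst μ) (hμ.memLp.comp_snd M.law)
    ((hM.memLp_apply j).comp_fst μ)
  refine h.trans ?_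
  have h0 := covariance_fst_snd_prod (hM.memLp_apply j) hμ.memLp
  rw [covariance_comm] at h0
  have h1 : cov[fun q : Obs k × ℝ => δ ⬝ᵥ q.1, fun q => q.1 j; M.law.prod μ] =
      cov[fun x => δ ⬝ᵥ x, fun x => x j; M.law] := by
    conv_rhs => rw [← (measurePreserving_fst (μ := M.law) (ν := μ)).map_eq]
    rw [covariance_map (by fun_prop) (measurable_pi_apply j).aestronglyMeasurable (by fun_prop)]
    rfl
  have h2 : cov[fun z : Obs k × ℝ => id z.2, fun q => q.1 j; M.law.prod μ] = 0 := h0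
  rw [h1, h2, add_zero]

/-- Coefficients whose residual is uncorrelated with the predictors in `S` are determined. -/
lemma eq_of_covariance_eq_zero (hpos : ∀ j, 0 < Var[id; M.noise j]) {S : Set (Fin k)}
    {δ δ' : Fin k → ℝ} (hS : ∀ j ∉ S, δ j = δ' j)
    (h : ∀ j ∈ S, cov[fun q : Obs k × ℝ => δ ⬝ᵥ q.1 + q.2, fun q => q.1 j; M.law.prod μ] = 0)
    (h' : ∀ j ∈ S, cov[fun q : Obs k × ℝ => δ' ⬝ᵥ q.1 + q.2, fun q => q.1 j; M.law.prod μ] = 0) :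
    δ = δ' := by
  have := hM.isProbabilityMeasure
  simp only [hM.covariance_residual hμ] at h h'
  rw [← sub_eq_zero]
  apply hM.eq_zero_of_variance_eq_zero hpos
  -- The variance of `⟨δ - δ', X⟩` is `∑ j, (δ - δ') j * cov(⟨δ - δ', X⟩, X_j)`. The covariance
  -- vanishes for `j ∈ S`, the coefficient for `j ∉ S`.
  rw [← covariance_self (by fun_prop)]
  have hx : (fun x : Obs k => (δ - δ') ⬝ᵥ x) = fun x => ∑ j, (δ - δ') j * x j := rfl
  conv_lhs => enter [2]; rw [hx]
  rw [covariance_fun_sum_right (fun j => (hM.memLp_apply j).const_mul _) (hM.memLp _)]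
  refine Finset.sum_eq_zero fun j _ => ?_
  rw [covariance_const_mul_right]
  by_cases hj : j ∈ S
  · have : cov[fun x => (δ - δ') ⬝ᵥ x, fun x => x j; M.law] = 0 := by
      simp only [sub_dotProduct]
      rw [covariance_fun_sub_left (hM.memLp _) (hM.memLp _) (hM.memLp_apply j), h j hj, h' j hj,
        sub_zero]
    rw [this, mul_zero]
  · simp [hS j hj]

end Residual

end Regular

end SEM

/-! ### The causal graph -/

namespace Model

/-- The linear coefficients of the mechanism of a target. -/
def targetCoef (M : Model A k) (a : A) : Option (Fin k) → Fin k → ℝ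
  | none => M.rewCoef a
  | some i => M.trCoef a i

/-- The noise law of the mechanism of a target. -/
def targetNoise (M : Model A k) (a : A) : Option (Fin k) → Measure ℝ
  | none => M.rewNoise a
  | some i => M.trNoise a i

/-- The reward and the next values of the variables in `AN(R)`. -/
def causalTargets (M : Model A k) : Set (Option (Fin k)) :=
  {v | ∀ i, v = some i → i ∈ M.ancestors}

lemma none_mem_causalTargets (M : Model A k) : none ∈ M.causalTargets := by
  simp [causalTargets]

lemma some_mem_causalTargets {M : Model A k} {i : Fin k} (hi : i ∈ M.ancestors) :
    some i ∈ M.causalTargets := by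
  simpa [causalTargets] using hi

lemma mem_parents {M : Model A k} {v : Option (Fin k)} {j : Fin k} :
    j ∈ M.parents v ↔ ∃ a, M.targetCoef a v j ≠ 0 := by
  cases v <;> rfl

lemma parents_subset_ancestors {M : Model A k} {v : Option (Fin k)} (hv : v ∈ M.causalTargets) :
    M.parents v ⊆ M.ancestors := by
  intro j hj
  cases v with
  | none => exact ⟨j, hj, .refl⟩
  | some i =>
    obtain ⟨r, hr, hir⟩ := hv i rfl
    exact ⟨r, hr, .head hj hir⟩

/-- Induction along the path back from the reward. Closure under parents is required only at
ancestors, where ICP is under control. -/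
lemma ancestors_subset {M : Model A k} {T : Set (Fin k)} (h0 : M.parents none ⊆ T)
    (h1 : ∀ i ∈ M.ancestors, i ∈ T → M.parents (some i) ⊆ T) : M.ancestors ⊆ T := by
  rintro j ⟨r, hr, hjr⟩
  induction hjr using Relation.ReflTransGen.head_induction_on with
  | refl => exact h0 hr
  | head hjc hcr ih => exact h1 _ ⟨r, hr, hcr⟩ ih hjc

/-- Parents can be compared only at targets that are causal for both models; the induction from the
reward never leaves these. -/
lemma ancestors_subset_ancestors {M M' : Model A k}
    (h : ∀ v ∈ M.causalTargets, v ∈ M'.causalTargets → M.parents v ⊆ M'.parents v) :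
    M.ancestors ⊆ M'.ancestors :=
  ancestors_subset
    ((h _ M.none_mem_causalTargets M'.none_mem_causalTargets).trans
      (parents_subset_ancestors M'.none_mem_causalTargets))
    fun _ hi hi' => (h _ (some_mem_causalTargets hi) (some_mem_causalTargets hi')).trans
      (parents_subset_ancestors (some_mem_causalTargets hi'))

end Model

/-! ### Laws of residuals -/

lemma indepFun_map_iff {Ω Ω' α β : Type*} [MeasurableSpace Ω] [MeasurableSpace Ω']
    [MeasurableSpace α] [MeasurableSpace β] {P : Measure Ω} {h : Ω → Ω'} {f : Ω' → α} {g : Ω' → β}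
    (hh : Measurable h) (hf : Measurable f) (hg : Measurable g) :
    IndepFun f g (P.map h) ↔ IndepFun (f ∘ h) (g ∘ h) P := by
  rw [indepFun_iff_measure_inter_preimage_eq_mul, indepFun_iff_measure_inter_preimage_eq_mul]
  refine forall_congr' fun s => forall_congr' fun t => forall_congr' fun hs =>
    forall_congr' fun ht => ?_
  rw [Measure.map_apply hh (hf hs), Measure.map_apply hh (hg ht),
    Measure.map_apply hh ((hf hs).inter (hg ht))]
  rfl

lemma measurable_targetValue (v : Option (Fin k)) :
    Measurable (targetValue v : Obs k × ℝ × Obs k → ℝ) := by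
  cases v with
  | none => exact measurable_snd.fst
  | some i => exact (measurable_pi_apply i).comp measurable_snd.snd

lemma measurable_residual (v : Option (Fin k)) (γ : Fin k → ℝ) : Measurable (residual v γ) :=
  (measurable_targetValue v).sub ((measurable_dotProduct γ).comp measurable_fst)

lemma measurable_residualPair (v : Option (Fin k)) (β : Fin k → ℝ) :
    Measurable (fun p : Obs k × ℝ × Obs k => (p.1, residual v β p)) :=
  measurable_fst.prodMk (measurable_residual _ _)

lemma residual_eq_add (v : Option (Fin k)) (β γ : Fin k → ℝ) (p : Obs k × ℝ × Obs k) :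
    residual v γ p = (β - γ) ⬝ᵥ p.1 + residual v β p := by
  simp only [residual, sub_dotProduct]
  ring

lemma measurable_mulVec_add (B : Matrix (Fin k) (Fin k) ℝ) :
    Measurable (fun p : Obs k × Obs k => B.mulVec p.1 + p.2) := by
  unfold Matrix.mulVec dotProduct
  fun_prop

lemma measurable_dotProduct_add (δ : Fin k → ℝ) :
    Measurable (fun q : Obs k × ℝ => δ ⬝ᵥ q.1 + q.2) :=
  ((measurable_dotProduct δ).comp measurable_fst).add measurable_snd

lemma measurable_predictors (S : Set (Fin k)) :
    Measurable (fun (x : Obs k) (j : S) => x j) :=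
  measurable_pi_lambda _ fun _ => measurable_pi_apply _

namespace IsBlockFamily

variable {M : Model A k} {env : ι → Environment A k} (h : IsBlockFamily M env)
include h

lemma targetNoise (a : A) (v : Option (Fin k)) : SquareIntegrableLaw (M.targetNoise a v) := by
  cases v with
  | none => exact h.rewNoise a
  | some i => exact h.trNoise a i

lemma regular_state : M.state.Regular :=
  ⟨h.stateNoise, h.stateAcyclic.isUnit_det⟩

lemma isProbabilityMeasure_law (e : ι) : IsProbabilityMeasure (env e).state.law :=
  (env e).state.isProbabilityMeasure_law (h.envStateNoise e)

/-- This is where the block structure enters: the mechanism of `v` is that of `M` in every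
environment, so the causal residual is its noise, independent of the state. Statements about
recorded data thereby become statements about a product measure. -/
lemma map_dataLaw {v : Option (Fin k)} (hv : v ∈ M.causalTargets) (e : ι) (a : A) :
    (M.dataLaw (env e) a).map (fun p => (p.1, residual v (M.targetCoef a v) p)) =
      (env e).state.law.prod (M.targetNoise a v) := by
  have := h.isProbabilityMeasure_law e
  have := (h.rewNoise a).1
  have := fun i => h.envTrNoise e a i
  have hmeas : Measurable (fun p : Obs k × ℝ × Obs k =>
      (p.1, M.rewCoef a ⬝ᵥ p.1 + p.2.1, ((env e).trCoef a).mulVec p.1 + p.2.2)) :=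
    measurable_fst.prodMk <|
      (((measurable_dotProduct _).comp measurable_fst).add measurable_snd.fst).prodMk <|
        (measurable_mulVec_add _).comp (measurable_fst.prodMk measurable_snd.snd)
  rw [Model.dataLaw, Measure.map_map (measurable_residualPair _ _) hmeas]
  cases v with
  | none =>
    have hp := (MeasurePreserving.id (env e).state.law).prod
      (measurePreserving_fst (μ := M.rewNoise a) (ν := Measure.pi ((env e).trNoise a)))
    rw [Model.targetNoise, ← hp.map_eq]
    congr 1
    ext p <;> simp [residual, targetValue, Model.targetCoef]
  | some i =>
    have hp := (MeasurePreserving.id (env e).state.law).prod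
      ((measurePreserving_eval ((env e).trNoise a) i).comp
        (measurePreserving_snd (μ := M.rewNoise a) (ν := Measure.pi ((env e).trNoise a))))
    obtain ⟨hc, hn⟩ := h.block e i (hv i rfl) a
    rw [Model.targetNoise, ← hn, ← hp.map_eq]
    congr 1
    ext p <;> simp [residual, targetValue, Model.targetCoef, ← hc, Matrix.mulVec]

lemma map_residual {v : Option (Fin k)} (hv : v ∈ M.causalTargets) (e : ι) (a : A)
    (γ : Fin k → ℝ) :
    (M.dataLaw (env e) a).map (residual v γ) =
      ((env e).state.law.prod (M.targetNoise a v)).map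
        (fun q => (M.targetCoef a v - γ) ⬝ᵥ q.1 + q.2) := by
  rw [← h.map_dataLaw hv e a,
    Measure.map_map (measurable_dotProduct_add _) (measurable_residualPair _ _)]
  congr 1
  ext p
  exact residual_eq_add _ _ _ _

lemma indepFun_residual_iff {v : Option (Fin k)} (hv : v ∈ M.causalTargets) (e : ι) (a : A)
    (γ : Fin k → ℝ) (S : Set (Fin k)) :
    IndepFun (residual v γ) (fun p (j : S) => p.1 j) (M.dataLaw (env e) a) ↔
      IndepFun (fun q : Obs k × ℝ => (M.targetCoef a v - γ) ⬝ᵥ q.1 + q.2)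
        (fun q (j : S) => q.1 j) ((env e).state.law.prod (M.targetNoise a v)) := by
  rw [← h.map_dataLaw hv e a, indepFun_map_iff (measurable_residualPair _ _)
    (measurable_dotProduct_add _) (g := fun (q : Obs k × ℝ) (j : S) => q.1 j)
    ((measurable_predictors S).comp measurable_fst)]
  have : residual v γ = (fun q : Obs k × ℝ => (M.targetCoef a v - γ) ⬝ᵥ q.1 + q.2) ∘
      (fun p : Obs k × ℝ × Obs k => (p.1, residual v (M.targetCoef a v) p)) :=
    funext fun p => residual_eq_add _ _ _ _
  rw [← this]
  rfl

/-- The residual of the causal mechanism is independent of the current state. -/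
lemma indepFun_residual_targetCoef {v : Option (Fin k)} (hv : v ∈ M.causalTargets) (e : ι) (a : A)
    (S : Set (Fin k)) :
    IndepFun (residual v (M.targetCoef a v)) (fun p (j : S) => p.1 j) (M.dataLaw (env e) a) := by
  have := h.isProbabilityMeasure_law e
  have := (h.targetNoise a v).1
  rw [h.indepFun_residual_iff hv]
  simpa using (indepFun_prod (μ := (env e).state.law) (ν := M.targetNoise a v)
    (measurable_predictors S) measurable_id).symm

lemma invariantSet_parents (train : Set ι) {v : Option (Fin k)} (hv : v ∈ M.causalTargets) :
    InvariantSet (fun e => M.dataLaw (env e)) train v (M.parents v) := by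
  refine ⟨fun a => M.targetCoef a v, fun a j hj => ?_, fun a => M.targetNoise a v,
    fun e _ a => ⟨?_, h.indepFun_residual_targetCoef hv e a _⟩⟩
  · by_contra hne
    exact hj (Model.mem_parents.2 ⟨a, hne⟩)
  · have := h.isProbabilityMeasure_law e
    have := (h.targetNoise a v).1
    rw [h.map_residual hv]
    simp

/-- The only consequence of independence that the converse direction uses. Regularity is needed
because an arbitrary environment may have noise without second moments. -/
lemma covariance_eq_zero {v : Option (Fin k)} (hv : v ∈ M.causalTargets) {e : ι}
    (he : (env e).state.Regular) {a : A} {γ : Fin k → ℝ} {S : Set (Fin k)}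
    (hind : IndepFun (residual v γ) (fun p (j : S) => p.1 j) (M.dataLaw (env e) a)) :
    ∀ j ∈ S, cov[fun q : Obs k × ℝ => (M.targetCoef a v - γ) ⬝ᵥ q.1 + q.2, fun q => q.1 j;
      (env e).state.law.prod (M.targetNoise a v)] = 0 := by
  intro j hj
  have := h.isProbabilityMeasure_law e
  have := (h.targetNoise a v).1
  rw [h.indepFun_residual_iff hv] at hind
  have hind' := hind.comp measurable_id (measurable_pi_apply (⟨j, hj⟩ : S))
  exact IndepFun.covariance_eq_zero hind' (he.memLp_residual (h.targetNoise a v) _)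
    ((he.memLp_apply j).comp_fst _)

/-- Under the common observational law both coefficient vectors leave a residual uncorrelated with
every `X_j`, and nondegeneracy of the covariance allows only one such vector. -/
lemma targetCoef_eq_of_dataLaw_eq {M' : Model A k} {env' : ι → Environment A k}
    (h' : IsBlockFamily M' env') {e : ι} (he : (env e).state = M.state) {a : A}
    (hD : M'.dataLaw (env' e) a = M.dataLaw (env e) a) {v : Option (Fin k)}
    (hv : v ∈ M.causalTargets) (hv' : v ∈ M'.causalTargets) :
    M'.targetCoef a v = M.targetCoef a v := by
  have hreg : (env e).state.Regular := he ▸ h.regular_state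
  have hind := h'.indepFun_residual_targetCoef hv' e a Set.univ
  rw [hD] at hind
  have hcov := h.covariance_eq_zero hv hreg hind
  have hcov' := h.covariance_eq_zero hv hreg (h.indepFun_residual_targetCoef hv e a Set.univ)
  have := hreg.eq_of_covariance_eq_zero (h.targetNoise a v) (by rw [he]; exact h.stateVar)
    (by simp) hcov hcov'
  exact sub_right_injective this

end IsBlockFamily

/-! ### Identifiability from invariance -/

lemma linearMISA_succ (D : ι → A → Measure (Obs k × ℝ × Obs k)) (train : Set ι) (n : ℕ) :
    linearMISA D train (n + 1) =
      icp D train none ∪ ⋃ v ∈ linearMISA D train n, icp D train (some v) := by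
  rw [linearMISA, Function.iterate_succ_apply']
  rfl

lemma linearMISA_subset_succ (D : ι → A → Measure (Obs k × ℝ × Obs k)) (train : Set ι) (n : ℕ) :
    linearMISA D train n ⊆ linearMISA D train (n + 1) := by
  induction n with
  | zero => exact Set.empty_subset _
  | succ n ih =>
    rw [linearMISA_succ, linearMISA_succ]
    exact Set.union_subset_union_right _ (Set.biUnion_subset_biUnion_left ih)

/-- Iterated ICP is stationary after `k` rounds. -/
lemma linearMISA_stationary (D : ι → A → Measure (Obs k × ℝ × Obs k)) (train : Set ι) {n : ℕ}
    (hn : k ≤ n) : linearMISA D train (n + 1) = linearMISA D train n := by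
  have heq : ∀ m, (linearMISA D train m).ncard = (linearMISA D train (m + 1)).ncard →
      linearMISA D train m = linearMISA D train (m + 1) := fun m hm =>
    Set.eq_of_subset_of_ncard_le (linearMISA_subset_succ D train m) hm.ge (Set.toFinite _)
  have hstab : ∀ n, k ≤ n → (linearMISA D train n).ncard = (linearMISA D train k).ncard := by
    intro n hn
    -- The cardinalities increase, are at most `k`, and stay constant after the first repetition,
    -- which therefore occurs by round `k`.
    refine Nat.stabilises_of_monotone (f := fun n => (linearMISA D train n).ncard) (b := k)
      (monotone_nat_of_le_succ fun m =>
        Set.ncard_le_ncard (linearMISA_subset_succ D train m) (Set.toFinite _))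
      (fun m => ?_) (fun m hm => ?_) hn
    · have := Set.ncard_le_card (linearMISA D train m)
      simpa using this
    · show Set.ncard _ = Set.ncard _
      rw [linearMISA_succ D train (m + 1), ← heq m hm, ← linearMISA_succ, hm]
  refine (heq n ?_).symm
  rw [hstab n hn, hstab (n + 1) (by omega)]

/-- The causal feature set is identifiable once every invariant set contains the causal parents. -/
theorem IsBlockFamily.identifiable [Nonempty A] {M : Model A k} {env : ι → Environment A k}
    (h : IsBlockFamily M env) {train : Set ι} (hobs : ∃ e ∈ train, (env e).state = M.state)
    (hsub : ∀ v ∈ M.causalTargets, ∀ S,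
      InvariantSet (fun e => M.dataLaw (env e)) train v S → M.parents v ⊆ S) :
    Identifiable M env train := by
  have hicp : ∀ v ∈ M.causalTargets,
      icp (fun e => M.dataLaw (env e)) train v = M.parents v := fun v hv =>
    Set.Subset.antisymm (fun j hj => hj.2 _ (h.invariantSet_parents train hv))
      fun j hj => ⟨⟨_, h.invariantSet_parents train hv⟩, fun S hS => hsub v hv S hS hj⟩
  refine ⟨hicp _ M.none_mem_causalTargets,
    fun v hv => hicp _ (Model.some_mem_causalTargets hv), fun n hn => ?_,
    fun M' env' h' hD => ?_⟩
  · apply Set.Subset.antisymm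
    · clear hn
      induction n with
      | zero => exact Set.empty_subset _
      | succ n ih =>
        rw [linearMISA_succ]
        refine Set.union_subset ?_ (Set.iUnion₂_subset fun v hv => ?_)
        · rw [hicp _ M.none_mem_causalTargets]
          exact Model.parents_subset_ancestors M.none_mem_causalTargets
        · have hv' := Model.some_mem_causalTargets (ih hv)
          rw [hicp _ hv']
          exact Model.parents_subset_ancestors hv'
    · have hstat := linearMISA_stationary (fun e => M.dataLaw (env e)) train hn
      refine Model.ancestors_subset ?_ fun i hi hin => ?_
      · rw [← hicp _ M.none_mem_causalTargets, ← hstat, linearMISA_succ]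
        exact Set.subset_union_left
      · rw [← hicp _ (Model.some_mem_causalTargets hi), ← hstat, linearMISA_succ]
        exact (Set.subset_biUnion_of_mem
          (u := fun v => icp (fun e => M.dataLaw (env e)) train (some v)) hin).trans
          Set.subset_union_right
  · obtain ⟨e, he, hst⟩ := hobs
    have hpar : ∀ v, v ∈ M.causalTargets → v ∈ M'.causalTargets →
        M'.parents v = M.parents v := fun v hv hv' => by
      ext j
      simp only [Model.mem_parents]
      exact exists_congr fun a => by
        rw [h.targetCoef_eq_of_dataLaw_eq h' hst (hD e he a) hv hv']
    exact Set.Subset.antisymm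
      (Model.ancestors_subset_ancestors fun v hv' hv => (hpar v hv hv').subset)
      (Model.ancestors_subset_ancestors fun v hv hv' => (hpar v hv hv').superset)

/-- The residual of an invariant set keeps its first two moments over the training environments and
is uncorrelated with the predictors. -/
lemma IsBlockFamily.exists_moments_eq {M : Model A k} {env : ι → Environment A k}
    (h : IsBlockFamily M env) {train : Set ι} {v : Option (Fin k)} (hv : v ∈ M.causalTargets)
    {S : Set (Fin k)} (hS : InvariantSet (fun e => M.dataLaw (env e)) train v S) :
    ∃ γ : A → Fin k → ℝ, (∀ a, ∀ j ∉ S, γ a j = 0) ∧ ∀ a,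
      (∀ e ∈ train, ∀ e' ∈ train, (env e).state.Regular → (env e').state.Regular →
        ∫ x, (M.targetCoef a v - γ a) ⬝ᵥ x ∂(env e).state.law =
          ∫ x, (M.targetCoef a v - γ a) ⬝ᵥ x ∂(env e').state.law ∧
        Var[fun x => (M.targetCoef a v - γ a) ⬝ᵥ x; (env e).state.law] =
          Var[fun x => (M.targetCoef a v - γ a) ⬝ᵥ x; (env e').state.law]) ∧
      ∀ e ∈ train, (env e).state.Regular → ∀ j ∈ S,
        cov[fun q : Obs k × ℝ => (M.targetCoef a v - γ a) ⬝ᵥ q.1 + q.2, fun q => q.1 j;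
          (env e).state.law.prod (M.targetNoise a v)] = 0 := by
  obtain ⟨γ, hγ, F, hF⟩ := hS
  refine ⟨γ, hγ, fun a => ⟨fun e he e' he' hr hr' => ?_, fun e he hr =>
    h.covariance_eq_zero hv hr (hF e he a).2⟩⟩
  have hlaw := (hF e he a).1.trans (hF e' he' a).1.symm
  rw [h.map_residual hv, h.map_residual hv] at hlaw
  -- The noise of the target contributes the same mean and variance on both sides of `hlaw`, so it
  -- cancels.
  have hm := measurable_dotProduct_add (M.targetCoef a v - γ a)
  constructor
  · have := congrArg (fun P : Measure ℝ => ∫ r, r ∂P) hlaw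
    beta_reduce at this
    rw [integral_map hm.aemeasurable (by fun_prop), integral_map hm.aemeasurable (by fun_prop),
      hr.integral_residual (h.targetNoise a v), hr'.integral_residual (h.targetNoise a v)] at this
    exact add_right_cancel this
  · have := congrArg (fun P : Measure ℝ => Var[id; P]) hlaw
    beta_reduce at this
    rw [variance_id_map hm.aemeasurable, variance_id_map hm.aemeasurable,
      hr.variance_residual (h.targetNoise a v), hr'.variance_residual (h.targetNoise a v)] at this
    exact add_right_cancel this

lemma parents_subset_of_targetCoef_eq {M : Model A k} {v : Option (Fin k)} {S : Set (Fin k)}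
    {γ : A → Fin k → ℝ} (hγ : ∀ a, ∀ j ∉ S, γ a j = 0) (h : ∀ a, M.targetCoef a v - γ a = 0) :
    M.parents v ⊆ S := by
  intro j hj
  obtain ⟨a, ha⟩ := Model.mem_parents.1 hj
  by_contra hjS
  exact ha (by rw [sub_eq_zero.1 (h a), hγ a j hjS])

/-! ### Do-interventions -/

lemma SEM.Regular.doAt {M : SEM k} (hM : M.Regular) {j : Fin k} {c : ℝ}
    (hC : Acyclic (M.doAt j c).coef) : (M.doAt j c).Regular := by
  refine ⟨fun i => ?_, hC.isUnit_det⟩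
  by_cases hi : i = j
  · subst hi
    simpa [SEM.doAt] using squareIntegrableLaw_dirac c
  · simpa [SEM.doAt, hi] using hM.noise i

/-- The mean vectors `m`, `m'` before and after the intervention satisfy the same equations outside
row `j`, so `m' - m = (1 - C)⁻¹ (t e_j)`. Here `t ≠ 0`, since `m' j = c` differs from `m j`. Thus
`⟨δ, m' - m⟩` is `t` times the `j`-th noise weight. -/
lemma SEM.Regular.noiseWeights_eq_zero_of_doAt {M : SEM k} (hM : M.Regular) {j : Fin k} {c : ℝ}
    (hM' : (M.doAt j c).Regular) (hc : c ≠ ∫ x, x j ∂M.law) {δ : Fin k → ℝ}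
    (hδ : ∫ x, δ ⬝ᵥ x ∂M.law = ∫ x, δ ⬝ᵥ x ∂(M.doAt j c).law) : M.noiseWeights δ j = 0 := by
  rw [hM.integral_dotProduct_eq_dotProduct_mean, hM'.integral_dotProduct_eq_dotProduct_mean] at hδ
  have hm := hM.mulVec_mean
  have hm' := hM'.mulVec_mean
  set m : Fin k → ℝ := fun i => ∫ x, x i ∂M.law
  set m' : Fin k → ℝ := fun i => ∫ x, x i ∂(M.doAt j c).law
  have hcm : c ≠ m j := hc
  have hj : m' j = c := by
    have := congrFun hm' j
    simpa [SEM.doAt, Matrix.sub_mulVec, Matrix.mulVec, Matrix.one_apply,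
      dotProduct] using this
  have hd : (1 - M.coef).mulVec (m' - m) =
      Pi.single j ((1 - M.coef).mulVec (m' - m) j) := by
    ext i
    by_cases hi : i = j
    · subst hi; simp
    · have h1 := congrFun hm i
      have h2 := congrFun hm' i
      have h3 : (1 - (M.doAt j c).coef).mulVec m' i = (1 - M.coef).mulVec m' i := by
        simp [SEM.doAt, Matrix.mulVec, hi]
      have h4 : (M.doAt j c).noise i = M.noise i := by simp [SEM.doAt, hi]
      rw [h3] at h2
      simp only [h4] at h2
      rw [Matrix.mulVec_sub, Pi.sub_apply, h2, h1]
      simp [hi]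
  set t := (1 - M.coef).mulVec (m' - m) j
  have hsolve : m' - m = (1 - M.coef)⁻¹.mulVec (Pi.single j t) := by
    rw [← hd, Matrix.mulVec_mulVec, Matrix.nonsing_inv_mul _ hM.isUnit, Matrix.one_mulVec]
  have ht : t ≠ 0 := by
    intro ht
    rw [ht, Pi.single_zero, Matrix.mulVec_zero] at hsolve
    have := congrFun hsolve j
    rw [Pi.sub_apply, hj, Pi.zero_apply, sub_eq_zero] at this
    exact hcm this
  have hz : δ ⬝ᵥ (m' - m) = 0 := by rw [dotProduct_sub, hδ, sub_self]
  rw [hsolve, SEM.dotProduct_solve, dotProduct_single] at hz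
  exact (mul_eq_zero.1 hz).resolve_right ht

theorem identifiable_of_doSufficient [Nonempty A] {M : Model A k} {env : ι → Environment A k}
    {train : Set ι} (h : IsBlockFamily M env) (hs : DoSufficient M env train) :
    Identifiable M env train := by
  obtain ⟨⟨e₀, he₀, hst₀⟩, hdo⟩ := hs
  refine h.identifiable ⟨e₀, he₀, hst₀⟩ fun v hv S hS => ?_
  obtain ⟨γ, hγ, hmom⟩ := h.exists_moments_eq hv hS
  refine parents_subset_of_targetCoef_eq hγ fun a =>
    SEM.noiseWeights_eq_zero h.regular_state.isUnit (funext fun j => ?_)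
  obtain ⟨e, he, c, hc, hst⟩ := hdo j
  have hreg' : (M.state.doAt j c).Regular :=
    h.regular_state.doAt (hst ▸ h.envStateAcyclic e)
  have := ((hmom a).1 e₀ he₀ e he (hst₀ ▸ h.regular_state) (hst ▸ hreg')).1
  rw [hst₀, hst] at this
  exact h.regular_state.noiseWeights_eq_zero_of_doAt hreg' hc this

/-! ### Noise interventions on one variable -/

lemma SEM.Regular.updateNoise {M : SEM k} (hM : M.Regular) (j : Fin k) {ν : Measure ℝ}
    (hν : SquareIntegrableLaw ν) : (SEM.mk M.coef (Function.update M.noise j ν)).Regular := by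
  refine ⟨fun i => ?_, hM.isUnit⟩
  by_cases hi : i = j
  · subst hi
    simpa using hν
  · simpa [hi] using hM.noise i

/-- If a functional of the state keeps its first two moments when the noise law of `X_j` is
replaced, then it does not depend on this noise, or the noise law keeps its moments. -/
lemma SEM.Regular.noiseWeights_eq_zero_of_updateNoise {M : SEM k} (hM : M.Regular) {j : Fin k}
    {ν : Measure ℝ} (hν : SquareIntegrableLaw ν)
    (hne : ∫ u, u ∂ν = ∫ u, u ∂M.noise j → Var[id; ν] ≠ Var[id; M.noise j]) {δ : Fin k → ℝ}
    (hint : ∫ x, δ ⬝ᵥ x ∂M.law =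
      ∫ x, δ ⬝ᵥ x ∂(SEM.mk M.coef (Function.update M.noise j ν)).law)
    (hvar : Var[fun x => δ ⬝ᵥ x; M.law] =
      Var[fun x => δ ⬝ᵥ x; (SEM.mk M.coef (Function.update M.noise j ν)).law]) :
    M.noiseWeights δ j = 0 := by
  have hM' := hM.updateNoise j hν
  have hw : (SEM.mk M.coef (Function.update M.noise j ν)).noiseWeights δ = M.noiseWeights δ := rfl
  rw [hM.integral_dotProduct, hM'.integral_dotProduct, hw] at hint
  rw [hM.variance_dotProduct, hM'.variance_dotProduct, hw] at hvar
  -- The two sums differ only in the term `j`. The function `f` is the mean, with the noise weights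
  -- as `w`, and then the variance, with their squares.
  have hsum : ∀ (w : Fin k → ℝ) (f : Measure ℝ → ℝ),
      ∑ i, w i * f (M.noise i) = ∑ i, w i * f (Function.update M.noise j ν i) →
      w j * f (M.noise j) = w j * f ν := by
    intro w f hwf
    rw [← Finset.add_sum_erase _ _ (Finset.mem_univ j),
      ← Finset.add_sum_erase _ (fun i => w i * f (Function.update M.noise j ν i))
        (Finset.mem_univ j),
      Finset.sum_congr rfl fun i hi => by
        rw [← Function.update_of_ne (Finset.ne_of_mem_erase hi) ν M.noise],
      Function.update_self] at hwf
    exact add_right_cancel hwf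
  replace hint := hsum _ (fun P => ∫ u, u ∂P) hint
  replace hvar := hsum (fun i => M.noiseWeights δ i ^ 2) (fun P => Var[id; P]) hvar
  by_contra h0
  exact hne (mul_left_cancel₀ h0 hint).symm
    (mul_left_cancel₀ (pow_ne_zero 2 h0) hvar).symm

lemma SquareIntegrableLaw.variance_eq {μ : Measure ℝ} (h : SquareIntegrableLaw μ) :
    Var[id; μ] = ∫ u, u ^ 2 ∂μ - (∫ u, u ∂μ) ^ 2 := by
  have := h.1
  rw [variance_eq_sub h.memLp]
  rfl

/-! ### First two moments of products and sums of independent noise. -/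

section MulAdd

variable {α ν : Measure ℝ} (hα : SquareIntegrableLaw α) (hν : SquareIntegrableLaw ν)
include hα hν

lemma SquareIntegrableLaw.mul :
    SquareIntegrableLaw ((α.prod ν).map (fun p => p.1 * p.2)) := by
  have := hα.1
  have := hν.1
  refine SquareIntegrableLaw.of_memLp (by fun_prop) ?_
  rw [memLp_two_iff_integrable_sq (by fun_prop)]
  simpa only [mul_pow] using hα.2.mul_prod hν.2

lemma SquareIntegrableLaw.add :
    SquareIntegrableLaw ((α.prod ν).map (fun p => p.1 + p.2)) := by
  have := hα.1
  have := hν.1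
  exact SquareIntegrableLaw.of_memLp (by fun_prop)
    ((hα.memLp.comp_fst ν).add (hν.memLp.comp_snd α))

/-- With equal means, equal variances would mean equal second moments, `E Z² · E η² = E η²`;
positive variance makes `E η² ≠ 0`, which forces `E Z² = 1`. -/
lemma SquareIntegrableLaw.moments_mul_ne (hpos : 0 < Var[id; ν]) (h1 : ∫ z, z ^ 2 ∂α ≠ 1)
    (hint : ∫ u, u ∂((α.prod ν).map (fun p => p.1 * p.2)) = ∫ u, u ∂ν) :
    Var[id; (α.prod ν).map (fun p => p.1 * p.2)] ≠ Var[id; ν] := by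
  have := hα.1
  have := hν.1
  intro hvar
  rw [(hα.mul hν).variance_eq, hν.variance_eq, hint, sub_left_inj,
    integral_map (by fun_prop) (by fun_prop)] at hvar
  simp only [mul_pow] at hvar
  rw [integral_prod_mul (fun z : ℝ => z ^ 2) (fun z : ℝ => z ^ 2)] at hvar
  rw [hν.variance_eq] at hpos
  have h2 : ∫ u, u ^ 2 ∂ν ≠ 0 := by nlinarith [sq_nonneg (∫ u, u ∂ν)]
  exact h1 (mul_right_cancel₀ h2 (by rw [hvar, one_mul]))

/-- Equal means force `E Z = 0`; then `Var Z > 0`, and variances of independent terms add. -/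
lemma SquareIntegrableLaw.moments_add_ne (h1 : ∫ z, z ∂α ≠ 0 ∨ 0 < Var[id; α])
    (hint : ∫ u, u ∂((α.prod ν).map (fun p => p.1 + p.2)) = ∫ u, u ∂ν) :
    Var[id; (α.prod ν).map (fun p => p.1 + p.2)] ≠ Var[id; ν] := by
  have := hα.1
  have := hν.1
  have ha : Integrable (fun p : ℝ × ℝ => p.1) (α.prod ν) :=
    (hα.memLp.comp_fst ν).integrable one_le_two
  have hb : Integrable (fun p : ℝ × ℝ => p.2) (α.prod ν) :=
    (hν.memLp.comp_snd α).integrable one_le_two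
  rw [integral_map (by fun_prop) (by fun_prop), integral_add ha hb,
    integral_fun_fst (fun u : ℝ => u), integral_fun_snd (fun u : ℝ => u)] at hint
  have h0 : ∫ z, z ∂α = 0 := by simpa using hint
  have hvar := variance_add_prod hα.memLp hν.memLp
  simp only [id_eq] at hvar
  rw [variance_id_map (by fun_prop), hvar]
  have := h1.resolve_left (not_not.2 h0)
  linarith

end MulAdd

theorem identifiable_of_noiseSufficient [Nonempty A] {M : Model A k} {env : ι → Environment A k}
    {train : Set ι} (h : IsBlockFamily M env) (hs : NoiseSufficient M env train) :
    Identifiable M env train := by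
  obtain ⟨⟨e₀, he₀, hst₀⟩, hnoise⟩ := hs
  refine h.identifiable ⟨e₀, he₀, hst₀⟩ fun v hv S hS => ?_
  obtain ⟨γ, hγ, hmom⟩ := h.exists_moments_eq hv hS
  refine parents_subset_of_targetCoef_eq hγ fun a =>
    SEM.noiseWeights_eq_zero h.regular_state.isUnit (funext fun j => ?_)
  have key : ∀ e ∈ train, ∀ ν, SquareIntegrableLaw ν →
      (env e).state = ⟨M.state.coef, Function.update M.state.noise j ν⟩ →
      (∫ u, u ∂ν = ∫ u, u ∂M.state.noise j → Var[id; ν] ≠ Var[id; M.state.noise j]) →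
      M.state.noiseWeights (M.targetCoef a v - γ a) j = 0 := by
    intro e he ν hν hst hne
    have := (hmom a).1 e₀ he₀ e he (hst₀ ▸ h.regular_state)
      (hst ▸ h.regular_state.updateNoise j hν)
    rw [hst₀, hst] at this
    exact h.regular_state.noiseWeights_eq_zero_of_updateNoise hν hne this.1 this.2
  obtain ⟨e, he, α, hα, ⟨h1, hst⟩ | ⟨h1, hst⟩⟩ := hnoise j
  · exact key e he _ (hα.mul (h.stateNoise j)) hst
      (hα.moments_mul_ne (h.stateNoise j) (h.stateVar j) h1)
  · exact key e he _ (hα.add (h.stateNoise j)) hst (hα.moments_add_ne (h.stateNoise j) h1)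

/-! ### Simultaneous noise interventions -/

/-- A nondegenerate diagonal quadric is a null set. -/
lemma ae_sum_mul_sq_ne {q : Fin k → ℝ} {j : Fin k} (hq : q j ≠ 0) (d : ℝ) :
    ∀ᵐ s : Fin k → ℝ, ∑ i, q i * s i ^ 2 ≠ d := by
  obtain ⟨n, rfl⟩ : ∃ n, k = n + 1 := ⟨k - 1, by have := j.pos; omega⟩
  let T : Set (ℝ × (Fin n → ℝ)) :=
    {p | q j * p.1 ^ 2 + ∑ i, q (j.succAbove i) * p.2 i ^ 2 = d}
  have hT : MeasurableSet T := measurableSet_eq_fun (by fun_prop) (by fun_prop)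
  have h0 : (volume : Measure (ℝ × (Fin n → ℝ))) T = 0 := by
    -- Fubini in the coordinate `j`: with the other coordinates fixed, a quadratic equation in `x`
    -- has at most two solutions `±√r`.
    rw [Measure.volume_eq_prod, Measure.prod_apply_symm hT]
    refine (lintegral_congr fun y => ?_).trans lintegral_zero
    refine Set.Finite.measure_zero ?_ _
    set r := (d - ∑ i, q (j.succAbove i) * y i ^ 2) / q j
    refine (Set.toFinite {√r, -√r}).subset fun x hx => ?_
    have hx' : q j * x ^ 2 + ∑ i, q (j.succAbove i) * y i ^ 2 = d := hx
    have hr : x ^ 2 = r := by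
      rw [eq_div_iff hq]
      linarith
    have := Real.sqrt_sq_eq_abs x
    rw [hr] at this
    rcases abs_choice x with h | h
    · left; rw [this, h]
    · right; rw [Set.mem_singleton_iff, this, h, neg_neg]
  have hpre := (volume_preserving_piFinSuccAbove (fun _ : Fin (n + 1) => ℝ) j).measure_preimage
    hT.nullMeasurableSet
  rw [h0] at hpre
  rw [ae_iff]
  convert! hpre using 2
  ext s
  simp [T, Fin.sum_univ_succAbove _ j, Fin.removeNth]

lemma SEM.Regular.scaleAll {M : SEM k} (hM : M.Regular) {C : Matrix (Fin k) (Fin k) ℝ}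
    (hC : Acyclic C) (s : Fin k → ℝ) : (M.scaleAll C s).Regular := by
  refine ⟨fun j => ?_, hC.isUnit_det⟩
  have := (hM.noise j).1
  exact SquareIntegrableLaw.of_memLp (by fun_prop) ((hM.noise j).memLp.const_mul _)

lemma SEM.variance_noise_scaleAll (M : SEM k) (C : Matrix (Fin k) (Fin k) ℝ) (s : Fin k → ℝ)
    (j : Fin k) : Var[id; (M.scaleAll C s).noise j] = s j ^ 2 * Var[id; M.noise j] := by
  simp only [SEM.scaleAll]
  rw [variance_id_map (by fun_prop)]
  exact variance_const_mul _ id _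

lemma SEM.Regular.ae_variance_scaleAll_ne {M : SEM k} (hM : M.Regular)
    (hpos : ∀ j, 0 < Var[id; M.noise j]) {C : Matrix (Fin k) (Fin k) ℝ} (hC : Acyclic C)
    {δ : Fin k → ℝ} (hδ : δ ≠ 0) (d : ℝ) :
    ∀ᵐ s : Fin k → ℝ, Var[fun x => δ ⬝ᵥ x; (M.scaleAll C s).law] ≠ d := by
  -- New coefficients with unscaled noise: the noise weights of `N` do not involve `s`, so the
  -- variance is a diagonal quadratic form in `s` with fixed coefficients.
  let N : SEM k := ⟨C, M.noise⟩
  have hw : ∃ j, N.noiseWeights δ j ≠ 0 := by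
    by_contra! h0
    exact hδ (SEM.noiseWeights_eq_zero (M := N) hC.isUnit_det (funext h0))
  obtain ⟨j, hj⟩ := hw
  filter_upwards [ae_sum_mul_sq_ne (q := fun i => N.noiseWeights δ i ^ 2 * Var[id; M.noise i])
    (mul_ne_zero (pow_ne_zero 2 hj) (hpos j).ne') d] with s hs
  rw [(hM.scaleAll hC s).variance_dotProduct]
  have hsum : ∑ i, (M.scaleAll C s).noiseWeights δ i ^ 2 * Var[id; (M.scaleAll C s).noise i] =
      ∑ i, N.noiseWeights δ i ^ 2 * Var[id; M.noise i] * s i ^ 2 := by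
    refine Finset.sum_congr rfl fun i _ => ?_
    rw [SEM.variance_noise_scaleAll]
    change N.noiseWeights δ i ^ 2 * _ = _
    ring
  rwa [hsum]

/-- For almost all scales, the only regression residual that keeps its variance is that of the
causal mechanism. -/
lemma SEM.Regular.ae_eq_zero_of_scaleAll {M : SEM k} (hM : M.Regular)
    (hpos : ∀ j, 0 < Var[id; M.noise j]) {C : Matrix (Fin k) (Fin k) ℝ} (hC : Acyclic C)
    {μ : Measure ℝ} (hμ : SquareIntegrableLaw μ) (β : Fin k → ℝ) (S : Set (Fin k)) :
    ∀ᵐ s : Fin k → ℝ, ∀ δ : Fin k → ℝ, (∀ j ∉ S, δ j = β j) →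
      (∀ j ∈ S, cov[fun q : Obs k × ℝ => δ ⬝ᵥ q.1 + q.2, fun q => q.1 j; M.law.prod μ] = 0) →
      Var[fun x => δ ⬝ᵥ x; M.law] = Var[fun x => δ ⬝ᵥ x; (M.scaleAll C s).law] → δ = 0 := by
  -- The null set has to be chosen before `δ`. At most one `δ` meets the first two conditions; if it
  -- is nonzero, its null set serves, and otherwise there is nothing to exclude.
  by_cases hex : ∃ δ₀ : Fin k → ℝ, (∀ j ∉ S, δ₀ j = β j) ∧
      (∀ j ∈ S, cov[fun q : Obs k × ℝ => δ₀ ⬝ᵥ q.1 + q.2, fun q => q.1 j; M.law.prod μ] = 0) ∧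
      δ₀ ≠ 0
  · obtain ⟨δ₀, hS, hcov, hne⟩ := hex
    filter_upwards [hM.ae_variance_scaleAll_ne hpos hC hne (Var[fun x => δ₀ ⬝ᵥ x; M.law])]
      with s hs δ hδS hδcov hvar
    obtain rfl := hM.eq_of_covariance_eq_zero hμ hpos
      (fun j hj => (hδS j hj).trans (hS j hj).symm) hδcov hcov
    exact absurd hvar.symm hs
  · refine Filter.Eventually.of_forall fun s δ hS hcov _ => ?_
    by_contra hne
    exact hex ⟨δ, hS, hcov, hne⟩

/-- The exceptional scales depend only on `M`, `C` and the finitely many triples `(v, a, S)`, so the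
environments and the training set can be quantified after `s`. -/
theorem ae_identifiable_of_simultaneous [Finite A] [Nonempty A] (M : Model A k)
    {C : Matrix (Fin k) (Fin k) ℝ} (hC : Acyclic C) {ρ : Measure (Fin k → ℝ)} (hρ : ρ ≪ volume) :
    ∀ᵐ s ∂ρ, ∀ (env : ι → Environment A k) (train : Set ι), IsBlockFamily M env →
      Simultaneous M env train C s → Identifiable M env train := by
  refine hρ.ae_le ?_
  -- The moment assumptions on `M` are part of `IsBlockFamily`, which is quantified after `s`;
  -- without any block family the claim is vacuous.
  by_cases hM : ∃ env : ι → Environment A k, IsBlockFamily M env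
  swap
  · exact Filter.Eventually.of_forall fun s env _ h => absurd ⟨env, h⟩ hM
  obtain ⟨env₀, h₀⟩ := hM
  have hae : ∀ᵐ s : Fin k → ℝ, ∀ (v : Option (Fin k)) (a : A) (S : Set (Fin k))
      (δ : Fin k → ℝ), (∀ j ∉ S, δ j = M.targetCoef a v j) →
      (∀ j ∈ S, cov[fun q : Obs k × ℝ => δ ⬝ᵥ q.1 + q.2, fun q => q.1 j;
        M.state.law.prod (M.targetNoise a v)] = 0) →
      Var[fun x => δ ⬝ᵥ x; M.state.law] = Var[fun x => δ ⬝ᵥ x; (M.state.scaleAll C s).law] →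
      δ = 0 := by
    simp only [ae_all_iff (ι := Option (Fin k)), ae_all_iff (ι := A),
      ae_all_iff (ι := Set (Fin k))]
    exact fun v a S => h₀.regular_state.ae_eq_zero_of_scaleAll h₀.stateVar hC
      (h₀.targetNoise a v) _ S
  filter_upwards [hae] with s hs env train h hsim
  obtain ⟨⟨e₀, he₀, hst₀⟩, e, he, hst⟩ := hsim
  refine h.identifiable ⟨e₀, he₀, hst₀⟩ fun v hv S hS => ?_
  obtain ⟨γ, hγ, hmom⟩ := h.exists_moments_eq hv hS
  refine parents_subset_of_targetCoef_eq hγ fun a => hs v a S _ (fun j hj => ?_) ?_ ?_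
  · simp [hγ a j hj]
  · have := (hmom a).2 e₀ he₀ (hst₀ ▸ h.regular_state)
    rwa [hst₀] at this
  · have := ((hmom a).1 e₀ he₀ e he (hst₀ ▸ h.regular_state)
      (hst ▸ h.regular_state.scaleAll hC s)).2
    rwa [hst₀, hst] at this

/-! ### Model-irrelevance with a constant variable -/

lemma measurable_restrictTo (S : Set (Fin k)) : Measurable (restrictTo S) :=
  measurable_predictors S

namespace Environment

variable (E : Environment A k)

lemma transition_eq_pi (hE : ∀ a i, IsProbabilityMeasure (E.trNoise a i)) (x : Obs k) (a : A) :
    E.transition x a = Measure.pi fun i => (E.trNoise a i).map (fun u => E.trCoef a i ⬝ᵥ x + u) := by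
  have := hE a
  have : ∀ i, IsProbabilityMeasure ((E.trNoise a i).map (fun u => E.trCoef a i ⬝ᵥ x + u)) :=
    fun i => Measure.isProbabilityMeasure_map (by fun_prop)
  rw [transition, ← Measure.pi_map_pi (μ := E.trNoise a)
    (f := fun i u => E.trCoef a i ⬝ᵥ x + u) fun i => by fun_prop]
  rfl

lemma map_restrictTo_transition (hE : ∀ a i, IsProbabilityMeasure (E.trNoise a i)) (x : Obs k)
    (a : A) (S : Set (Fin k)) [DecidablePred (· ∈ S)] :
    (E.transition x a).map (restrictTo S) =
      Measure.pi fun j : S => (E.trNoise a j).map (fun u => E.trCoef a j ⬝ᵥ x + u) := by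
  have := hE a
  have : ∀ i, IsProbabilityMeasure ((E.trNoise a i).map (fun u => E.trCoef a i ⬝ᵥ x + u)) :=
    fun i => Measure.isProbabilityMeasure_map (by fun_prop)
  rw [E.transition_eq_pi hE]
  exact (measurePreserving_fst.comp (measurePreserving_piEquivPiSubtypeProd
    (fun i => (E.trNoise a i).map (fun u => E.trCoef a i ⬝ᵥ x + u)) (· ∈ S))).map_eq

lemma map_eval_transition (hE : ∀ a i, IsProbabilityMeasure (E.trNoise a i)) (x : Obs k)
    (a : A) {S : Set (Fin k)} {i : Fin k} (hi : i ∈ S) :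
    ((E.transition x a).map (restrictTo S)).map (fun z => z ⟨i, hi⟩) =
      (E.trNoise a i).map (fun u => E.trCoef a i ⬝ᵥ x + u) := by
  have := hE a
  have : ∀ i, IsProbabilityMeasure ((E.trNoise a i).map (fun u => E.trCoef a i ⬝ᵥ x + u)) :=
    fun i => Measure.isProbabilityMeasure_map (by fun_prop)
  rw [Measure.map_map (measurable_pi_apply _) (measurable_restrictTo S), E.transition_eq_pi hE]
  exact (measurePreserving_eval (fun i => (E.trNoise a i).map
    (fun u => E.trCoef a i ⬝ᵥ x + u)) i).map_eq

lemma SetsNext.map_noise {E : Environment A k} {m : Fin k} {μ : Measure ℝ} (h : E.SetsNext m μ)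
    (x : Obs k) (a : A) : (E.trNoise a m).map (fun u => E.trCoef a m ⬝ᵥ x + u) = μ := by
  rw [(h a).1, (h a).2]
  simp

end Environment

lemma Model.targetCoef_dotProduct_eq {M : Model A k} {v : Option (Fin k)}
    (hv : v ∈ M.causalTargets) (a : A) {x y : Obs k} (hxy : ∀ i ∈ M.ancestors, x i = y i) :
    M.targetCoef a v ⬝ᵥ x = M.targetCoef a v ⬝ᵥ y := by
  refine Finset.sum_congr rfl fun j _ => ?_
  by_cases hj : M.targetCoef a v j = 0
  · simp [hj]
  · rw [hxy j (Model.parents_subset_ancestors hv (Model.mem_parents.2 ⟨a, hj⟩))]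

/-- The law of the abstract next state is a product, so coordinates can be compared one by one:
those in `AN(R)` depend on `x` only through `AN(R)`, and the coordinate `m` is a point mass at `c`.
-/
theorem IsBlockFamily.modelIrrelevant {M : Model A k} {env : ι → Environment A k}
    (h : IsBlockFamily M env) {train : Set ι} {m : Fin k} {c : ℝ}
    (hc : ∀ e ∈ train, (env e).SetsNext m (Measure.dirac c)) :
    ModelIrrelevant M env train (restrictTo (M.ancestors ∪ {m})) := by
  classical
  intro e he e' he' a x y hxy
  have hx : ∀ i ∈ M.ancestors, x i = y i := fun i hi => congrFun hxy ⟨i, Or.inl hi⟩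
  constructor
  · have := Model.targetCoef_dotProduct_eq M.none_mem_causalTargets a hx
    simp only [Model.targetCoef] at this
    rw [Model.expReward, Model.expReward, this]
  · rw [Environment.map_restrictTo_transition _ (h.envTrNoise e),
      Environment.map_restrictTo_transition _ (h.envTrNoise e')]
    congr 1
    ext1 ⟨i, hi⟩
    rcases hi with hi | hi
    · have := Model.targetCoef_dotProduct_eq (Model.some_mem_causalTargets hi) a hx
      simp only [Model.targetCoef] at this
      simp only [(h.block e i hi a).1, (h.block e i hi a).2, (h.block e' i hi a).1,
        (h.block e' i hi a).2, this]
    · obtain rfl : i = m := hi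
      exact ((hc e he).map_noise x a).trans ((hc e' he').map_noise y a).symm

lemma dirac_ne_gaussianReal (c : ℝ) {σ2 : NNReal} (hσ : σ2 ≠ 0) :
    Measure.dirac c ≠ gaussianReal c σ2 := by
  intro h
  have := nullSingletonClass_gaussianReal (μ := c) hσ
  have h1 := congrArg (fun P : Measure ℝ => P {c}) h
  simp at h1

theorem IsBlockFamily.not_modelIrrelevant_univ [Nonempty A] {M : Model A k}
    {env : ι → Environment A k} (h : IsBlockFamily M env) {train : Set ι} {m : Fin k} {c : ℝ}
    (hc : ∀ e ∈ train, (env e).SetsNext m (Measure.dirac c)) (hne : train.Nonempty)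
    (hg : ∃ (e : ι) (σ2 : NNReal), σ2 ≠ 0 ∧ (env e).SetsNext m (gaussianReal c σ2)) :
    ¬ ModelIrrelevant M env Set.univ (restrictTo (M.ancestors ∪ {m})) := by
  intro hirr
  obtain ⟨e, he⟩ := hne
  obtain ⟨e', σ2, hσ, hset⟩ := hg
  obtain ⟨a⟩ := ‹Nonempty A›
  -- The same observation in a training and in the Gaussian environment already separates the laws,
  -- through the coordinate `m`.
  have hlaw := (hirr e (Set.mem_univ _) e' (Set.mem_univ _) a 0 0 rfl).2
  have hm : m ∈ M.ancestors ∪ {m} := Or.inr rfl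
  have := congrArg (fun P => P.map (fun z => z ⟨m, hm⟩)) hlaw
  simp only [Environment.map_eval_transition _ (h.envTrNoise _),
    (hc e he).map_noise, hset.map_noise] at this
  exact dirac_ne_gaussianReal c hσ this

/-! ### A family with insufficient interventions -/

/-- The environment without intervention. -/
def Model.observational (M : Model A k) : Environment A k where
  trCoef := M.trCoef
  trNoise := M.trNoise
  state := M.state

/-- The intervention that draws `x_m` from `μ`, independently of everything else. -/
def Model.setVariable (M : Model A k) (m : Fin k) (μ : Measure ℝ) : Environment A k where
  trCoef := fun a => (M.trCoef a).updateRow m 0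
  trNoise := fun a => Function.update (M.trNoise a) m μ
  state := ⟨M.state.coef.updateRow m 0, Function.update M.state.noise m μ⟩

lemma Model.setsNext_setVariable (M : Model A k) (m : Fin k) (μ : Measure ℝ) :
    (M.setVariable m μ).SetsNext m μ := by
  intro a
  constructor
  · ext j
    simp [Model.setVariable]
  · simp [Model.setVariable]

/-- Three variables with standard Gaussian noise: `x₀` persists and is the reward up to noise,
`x₂` persists, and the next value of `x₁` is that of `x₂` up to noise. -/
noncomputable def distractorModel (A : Type*) : Model A 3 where
  rewCoef := fun _ => Pi.single 0 1
  rewNoise := fun _ => gaussianReal 0 1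
  trCoef := fun _ => Matrix.of ![![1, 0, 0], ![0, 0, 1], ![0, 0, 1]]
  trNoise := fun _ _ => gaussianReal 0 1
  state := ⟨0, fun _ => gaussianReal 0 1⟩

/-- `x₁ ← 0`, `x₁ ← N(0, 2)`, and no intervention. -/
noncomputable def distractorEnv (A : Type*) : Fin 3 → Environment A 3 :=
  ![(distractorModel A).setVariable 1 (Measure.dirac 0),
    (distractorModel A).setVariable 1 (gaussianReal 0 2),
    (distractorModel A).observational]

lemma acyclic_zero : Acyclic (0 : Matrix (Fin k) (Fin k) ℝ) := by
  intro i hi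
  obtain ⟨j, hj, _⟩ := Relation.TransGen.head'_iff.1 hi
  exact hj rfl

lemma squareIntegrableLaw_gaussianReal (c : ℝ) (σ2 : NNReal) :
    SquareIntegrableLaw (gaussianReal c σ2) :=
  ⟨inferInstance, (memLp_two_iff_integrable_sq aestronglyMeasurable_id).1
    (memLp_id_gaussianReal 2)⟩

lemma distractorModel_ancestors (A : Type*) : (distractorModel A).ancestors ⊆ {0} := by
  refine Model.ancestors_subset ?_ ?_
  · rintro j ⟨a, ha⟩
    by_contra hj
    exact ha (Pi.single_eq_of_ne hj 1)
  · rintro i - rfl j ⟨a, ha⟩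
    fin_cases j
    · rfl
    · exact absurd rfl ha
    · exact absurd rfl ha

lemma distractorEnv_cases {A : Type*} (P : Environment A 3 → Prop)
    (hset : ∀ μ : Measure ℝ, IsProbabilityMeasure μ → P ((distractorModel A).setVariable 1 μ))
    (hobs : P (distractorModel A).observational) (e : Fin 3) : P (distractorEnv A e) := by
  fin_cases e
  · exact hset _ inferInstance
  · exact hset _ inferInstance
  · exact hobs

lemma isBlockFamily_distractor (A : Type*) :
    IsBlockFamily (distractorModel A) (distractorEnv A) where
  rewNoise _ := squareIntegrableLaw_gaussianReal _ _
  trNoise _ _ := squareIntegrableLaw_gaussianReal _ _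
  stateNoise _ := squareIntegrableLaw_gaussianReal _ _
  stateVar j := by simp [distractorModel]
  stateAcyclic := acyclic_zero
  envTrNoise := by
    refine distractorEnv_cases (fun E => ∀ a i, IsProbabilityMeasure (E.trNoise a i))
      (fun μ hμ a i => ?_) fun a i => ?_
    · by_cases hi : i = 1
      · subst hi; simpa [Model.setVariable] using hμ
      · simp only [Model.setVariable, Function.update_of_ne hi]
        exact inferInstanceAs (IsProbabilityMeasure (gaussianReal 0 1))
    · exact inferInstanceAs (IsProbabilityMeasure (gaussianReal 0 1))
  envStateNoise := by
    refine distractorEnv_cases (fun E => ∀ i, IsProbabilityMeasure (E.state.noise i))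
      (fun μ hμ i => ?_) fun i => ?_
    · by_cases hi : i = 1
      · subst hi; simpa [Model.setVariable] using hμ
      · simp only [Model.setVariable, Function.update_of_ne hi]
        exact inferInstanceAs (IsProbabilityMeasure (gaussianReal 0 1))
    · exact inferInstanceAs (IsProbabilityMeasure (gaussianReal 0 1))
  envStateAcyclic := by
    refine distractorEnv_cases (fun E => Acyclic E.state.coef) (fun μ _ => ?_) acyclic_zero
    -- The observational coefficients are zero, so clearing row `1` changes nothing.
    have : ((distractorModel A).setVariable 1 μ).state.coef = 0 :=
      Matrix.updateRow_eq_self 0 1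
    rw [this]
    exact acyclic_zero
  block := by
    refine distractorEnv_cases (fun E => ∀ i ∈ (distractorModel A).ancestors, ∀ a,
        E.trCoef a i = (distractorModel A).trCoef a i ∧
        E.trNoise a i = (distractorModel A).trNoise a i)
      (fun μ _ i hi a => ?_) fun i _ a => ⟨rfl, rfl⟩
    obtain rfl : i = 0 := distractorModel_ancestors A hi
    have h01 : (0 : Fin 3) ≠ 1 := by decide
    exact ⟨Matrix.updateRow_ne h01, Function.update_of_ne h01 μ _⟩

lemma singleVariableInterventions_distractor (A : Type*) :
    SingleVariableInterventions (distractorModel A) (distractorEnv A) := by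
  refine distractorEnv_cases (fun E => ∃ i,
    (∀ j, j ≠ i → E.state.coef j = (distractorModel A).state.coef j ∧
      E.state.noise j = (distractorModel A).state.noise j ∧
      ∀ a, E.trCoef a j = (distractorModel A).trCoef a j ∧
        E.trNoise a j = (distractorModel A).trNoise a j) ∧
    (∀ j, (distractorModel A).state.coef i j = 0 → E.state.coef i j = 0) ∧
    (∀ a j, ¬ (distractorModel A).Edge j i → E.trCoef a i j = 0))
    (fun μ _ => ⟨1, fun j hj => ?_, fun j _ => ?_, fun a j _ => ?_⟩)
    -- The observational environment counts as the trivial intervention on `x₁`.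
    ⟨1, fun j _ => ⟨rfl, rfl, fun a => ⟨rfl, rfl⟩⟩, fun j hj => hj, fun a j hj => ?_⟩
  · exact ⟨Matrix.updateRow_ne hj, Function.update_of_ne hj _ _,
      fun a => ⟨Matrix.updateRow_ne hj, Function.update_of_ne hj _ _⟩⟩
  · simp [Model.setVariable]
  · simp [Model.setVariable]
  · by_contra hne
    exact hj ⟨a, hne⟩

/-- Shows that the single training environment is not observational, which rules out all three
sufficient conditions at once. -/
lemma distractor_doAt_ne (A : Type*) :
    (distractorModel A).state.doAt 1 0 ≠ (distractorModel A).state := by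
  intro h
  have := congrFun (congrArg SEM.noise h) 1
  simp only [SEM.doAt, distractorModel, Function.update_self] at this
  exact dirac_ne_gaussianReal 0 one_ne_zero this

/-- Without intervention `x₁` copies `x₂`, which the abstraction does not see: the states `0` and
`e₂` are identified, but the next value of `x₁` is `N(0, 1)` from one and `N(1, 1)` from the other.
-/
lemma not_modelIrrelevant_distractor (A : Type*) [Nonempty A] :
    ¬ ModelIrrelevant (distractorModel A) (distractorEnv A) {2}
      (restrictTo ((distractorModel A).ancestors ∪ {1})) := by
  intro hirr
  obtain ⟨a⟩ := ‹Nonempty A›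
  have hφ : restrictTo ((distractorModel A).ancestors ∪ {1}) (0 : Obs 3) =
      restrictTo ((distractorModel A).ancestors ∪ {1}) (Pi.single 2 1) := by
    ext ⟨i, hi⟩
    have hi2 : i ≠ 2 := by
      rintro rfl
      rcases hi with hi | hi
      · exact absurd (distractorModel_ancestors A hi) (by decide)
      · exact absurd hi (by decide)
    simp [restrictTo, hi2]
  have hlaw := (hirr 2 rfl 2 rfl a _ _ hφ).2
  have hm : (1 : Fin 3) ∈ (distractorModel A).ancestors ∪ {1} := Or.inr rfl
  have := congrArg (fun P => P.map (fun z => z ⟨1, hm⟩)) hlaw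
  simp only [Environment.map_eval_transition _ ((isBlockFamily_distractor A).envTrNoise _)] at this
  have hN : (distractorEnv A 2).trNoise a 1 = gaussianReal 0 1 := rfl
  have hB : (distractorEnv A 2).trCoef a 1 = Pi.single 2 1 := by
    ext j; fin_cases j <;> rfl
  rw [hN, hB, gaussianReal_map_const_add, gaussianReal_map_const_add, gaussianReal_ext_iff] at this
  simp at this

end CausalMISA

theorem mainTheorem2 {A ι : Type*} [Finite A] [Nonempty A] {k : ℕ} :
    -- identifiability under single-variable do- or noise interventions
    (∀ (M : CausalMISA.Model A k) (env : ι → CausalMISA.Environment A k) (train : Set ι),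
      CausalMISA.IsBlockFamily M env →
      CausalMISA.DoSufficient M env train ∨ CausalMISA.NoiseSufficient M env train →
      CausalMISA.Identifiable M env train) ∧
    -- identifiability, almost surely, under simultaneous noise interventions with scales `s` drawn
    -- from an absolutely continuous law
    (∀ (M : CausalMISA.Model A k) (C : Matrix (Fin k) (Fin k) ℝ) (ρ : Measure (Fin k → ℝ)),
      CausalMISA.Acyclic C → IsProbabilityMeasure ρ → ρ ≪ volume →
      ∀ᵐ s ∂ρ, ∀ (env : ι → CausalMISA.Environment A k) (train : Set ι),
        CausalMISA.IsBlockFamily M env →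
        CausalMISA.Simultaneous M env train C s →
        CausalMISA.Identifiable M env train) ∧
    -- a variable outside `AN(R)` that is constant in all training environments
    (∀ (M : CausalMISA.Model A k) (env : ι → CausalMISA.Environment A k) (train : Set ι)
      (m : Fin k) (c : ℝ),
      CausalMISA.IsBlockFamily M env → m ∉ M.ancestors →
      (∀ e ∈ train, (env e).SetsNext m (Measure.dirac c)) →
      CausalMISA.ModelIrrelevant M env train (CausalMISA.restrictTo (M.ancestors ∪ {m})) ∧
      (train.Nonempty → (∃ (e : ι) (σ2 : NNReal), σ2 ≠ 0 ∧
          (env e).SetsNext m (gaussianReal c σ2)) →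
        ¬ CausalMISA.ModelIrrelevant M env Set.univ
          (CausalMISA.restrictTo (M.ancestors ∪ {m})))) ∧
    -- such families exist; the abstraction may even fail in a single test environment
    (∃ (n : ℕ) (M : CausalMISA.Model A n) (env : Fin 3 → CausalMISA.Environment A n)
      (train : Set (Fin 3)) (m : Fin n) (c : ℝ),
      CausalMISA.IsBlockFamily M env ∧ CausalMISA.SingleVariableInterventions M env ∧
      train.Nonempty ∧ m ∉ M.ancestors ∧
      (∀ e ∈ train, (env e).SetsNext m (Measure.dirac c) ∧
        (env e).state = M.state.doAt m c) ∧
      ¬ CausalMISA.DoSufficient M env train ∧ ¬ CausalMISA.NoiseSufficient M env train ∧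
      (∀ C s, ¬ CausalMISA.Simultaneous M env train C s) ∧
      (∃ (e : Fin 3) (σ2 : NNReal), σ2 ≠ 0 ∧ (env e).SetsNext m (gaussianReal c σ2)) ∧
      CausalMISA.ModelIrrelevant M env train (CausalMISA.restrictTo (M.ancestors ∪ {m})) ∧
      ¬ CausalMISA.ModelIrrelevant M env Set.univ
        (CausalMISA.restrictTo (M.ancestors ∪ {m})) ∧
      ∃ e, ¬ CausalMISA.ModelIrrelevant M env {e}
        (CausalMISA.restrictTo (M.ancestors ∪ {m}))) := by
  refine ⟨fun M env train h hs => hs.elim (CausalMISA.identifiable_of_doSufficient h)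
      (CausalMISA.identifiable_of_noiseSufficient h),
    fun M C ρ hC _ hρ => CausalMISA.ae_identifiable_of_simultaneous M hC hρ,
    fun M env train m c h _ hc => ⟨h.modelIrrelevant hc, h.not_modelIrrelevant_univ hc⟩, ?_⟩
  have hblock := CausalMISA.isBlockFamily_distractor A
  have htrain : ∀ e ∈ ({0} : Set (Fin 3)),
      (CausalMISA.distractorEnv A e).SetsNext 1 (Measure.dirac 0) := by
    rintro e rfl
    exact CausalMISA.Model.setsNext_setVariable _ _ _
  have hgauss : ∃ (e : Fin 3) (σ2 : NNReal), σ2 ≠ 0 ∧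
      (CausalMISA.distractorEnv A e).SetsNext 1 (gaussianReal 0 σ2) :=
    ⟨1, 2, two_ne_zero, CausalMISA.Model.setsNext_setVariable _ _ _⟩
  have hobs : ¬ ∃ e ∈ ({0} : Set (Fin 3)),
      (CausalMISA.distractorEnv A e).state = (CausalMISA.distractorModel A).state := by
    rintro ⟨e, rfl, he⟩
    exact CausalMISA.distractor_doAt_ne A he
  exact ⟨3, CausalMISA.distractorModel A, CausalMISA.distractorEnv A, {0}, 1, 0, hblock,
    CausalMISA.singleVariableInterventions_distractor A, Set.singleton_nonempty 0,
    fun hm => absurd (CausalMISA.distractorModel_ancestors A hm) (by decide),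
    fun e he => ⟨htrain e he, by obtain rfl : e = 0 := he; rfl⟩,
    fun h => hobs h.1, fun h => hobs h.1, fun C s h => hobs h.1, hgauss,
    hblock.modelIrrelevant htrain,
    hblock.not_modelIrrelevant_univ htrain (Set.singleton_nonempty 0) hgauss,
    2, CausalMISA.not_modelIrrelevant_distractor A⟩
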